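/- Let $d\ge 2$ and $n\ge d+1$, and let $Y$ be a simplicial complex of dimension at most $d$ on the vertex set $\{1,\dots,n\}$ with complete $(d-1)$-skeleton (every set of at most $d$ vertices spans a face). Call the $(d-1)$-dimensional faces facets; a facet is isolated if no $d$-dimensional face of $Y$ contains it. For a $(d-1)$-cochain $\phi$ of $Y$ over a ring $R$, the weight $w(\phi)$ is the minimum of $|\operatorname{supp}\phi'|$ over all $\phi'$ such that $\phi-\phi'$ is a coboundary. A nonzero cocycle over a field is inclusion-minimal if no nonzero cocycle over that field is supported on a proper subset of its support. Consider the following conditions. 1. For every set $X$ of facets with $|X|\ge n/(3d)$ and every $R\in\{\mathbb Q\}\cup\{\mathbb Z/q\mathbb Z : q \text{ prime},\ q\le \sqrt{d+1}^{\,|X|}\}$, there is no $(d-1)$-cocycle $\phi$ of $Y$ over $R$ with $\operatorname{supp}\phi=X$ and $w(\phi)=|X|$. 2. Over no field does $Y$ have an inclusion-minimal $(d-1)$-cocycle of support size $k$ with $2\le k\le n/(3d)$. 3. No two distinct isolated facets of $Y$ meet at a ridge, i.e. share exactly $d-1$ vertices. If conditions 1 and 2 hold, then $H_{d-1}(Y;\mathbb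 Z)$ is a free abelian group of rank equal to the number of isolated facets of $Y$. If all three conditions hold, then the following is true for every realization $Y=Y_0\subset Y_1\subset\dots\subset Y_N$ of the process that adds the missing $d$-dimensional faces one at a time until none is missing, in whatever order (hence surely when the order is uniformly random): there is $T\le N$ such that for all $0\le k\le N$ the complex $Y_k$ has no isolated facet if and only if $k\ge T$, and $H_{d-1}(Y_k;\mathbb Z)=0$ if and only if $k\ge T$. That is, $H_{d-1}$ vanishes exactly at the moment the last isolated facet is covered. -/

import Mathlib

namespace LinialMeshulam

noncomputable section

/-- The `i`-dimensional faces of a simplicial complex `K` on the vertex set `Fin n`, that is, the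
faces with `i + 1` vertices. -/
abbrev Face {n : ℕ} (K : AbstractSimplicialComplex (Fin n)) (i : ℕ) : Type :=
  {s : Finset (Fin n) // s ∈ K.faces ∧ s.card = i + 1}

instance {n : ℕ} (K : AbstractSimplicialComplex (Fin n)) (i : ℕ) : Fintype (Face K i) :=
  Fintype.ofFinite _

/-- The incidence number `[s : t]`, for the orientations given by the order of the vertices: it is
`(-1) ^ k` if `t` is obtained from `s = {v₀ < v₁ < ⋯}` by deleting `v_k`, and it is `0` if `t` does
not arise from `s` by deleting one vertex. -/
def incidence {n : ℕ} (s t : Finset (Fin n)) : ℤ :=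
  ∑ v ∈ s, if s.erase v = t then (-1) ^ (s.filter (· < v)).card else 0

/-- The simplicial `i`-chains of `K`. Since there are finitely many faces these are all the
functions on the set of `i`-dimensional faces. -/
abbrev Chain {n : ℕ} (K : AbstractSimplicialComplex (Fin n)) (R : Type) (i : ℕ) : Type :=
  Face K i → R

/-- The simplicial `i`-cochains of `K` with coefficients in `R`. -/
abbrev Cochain {n : ℕ} (K : AbstractSimplicialComplex (Fin n)) (R : Type) (i : ℕ) : Type :=
  Face K i → R

/-- The boundary map `C_i(K; R) → C_j(K; R)`, `∂ s = ∑ t, [s : t] t`. It is of interest for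
`i = j + 1`, and it is zero for every other pair `(i, j)`. -/
def boundary {n : ℕ} (K : AbstractSimplicialComplex (Fin n)) (R : Type) [CommRing R] (i j : ℕ) :
    Chain K R i →ₗ[R] Chain K R j :=
  Matrix.mulVecLin (Matrix.of fun (t : Face K j) (s : Face K i) => ((incidence s.1 t.1 : ℤ) : R))

/-- The coboundary map `C^j(K; R) → C^i(K; R)`, `(δ φ)(s) = ∑ t, [s : t] φ(t)`. It is of interest
for `i = j + 1`, and it is zero for every other pair `(j, i)`. -/
def coboundary {n : ℕ} (K : AbstractSimplicialComplex (Fin n)) (R : Type) [CommRing R] (j i : ℕ) :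
    Cochain K R j →ₗ[R] Cochain K R i :=
  Matrix.mulVecLin (Matrix.of fun (s : Face K i) (t : Face K j) => ((incidence s.1 t.1 : ℤ) : R))

/-- The `i`-cocycles of `K` over `R`. -/
def cocycles {n : ℕ} (K : AbstractSimplicialComplex (Fin n)) (R : Type) [CommRing R] (i : ℕ) :
    Submodule R (Cochain K R i) :=
  LinearMap.ker (coboundary K R i (i + 1))

/-- The `i`-coboundaries of `K` over `R` (only zero if `i = 0`). -/
def coboundaries {n : ℕ} (K : AbstractSimplicialComplex (Fin n)) (R : Type) [CommRing R] (i : ℕ) :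
    Submodule R (Cochain K R i) :=
  LinearMap.range (coboundary K R (i - 1) i)

/-- The simplicial homology group `H_i(K; ℤ)`: the `i`-cycles modulo the `i`-boundaries. (For
`i = 0` every chain is a cycle, since `boundary K ℤ 0 0 = 0`.) -/
abbrev Homology {n : ℕ} (K : AbstractSimplicialComplex (Fin n)) (i : ℕ) : Type :=
  LinearMap.ker (boundary K ℤ i (i - 1)) ⧸
    (LinearMap.range (boundary K ℤ (i + 1) i)).submoduleOf (LinearMap.ker (boundary K ℤ i (i - 1)))

open Classical in
/-- The support of a cochain. -/
def supp {n : ℕ} {K : AbstractSimplicialComplex (Fin n)} {R : Type} [CommRing R] {i : ℕ}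
    (φ : Cochain K R i) : Finset (Face K i) :=
  Finset.univ.filter fun τ => φ τ ≠ 0

/-- The weight of a cochain: the minimal support size of a cochain that differs from it by a
coboundary. -/
def weight {n : ℕ} {K : AbstractSimplicialComplex (Fin n)} {R : Type} [CommRing R] {i : ℕ}
    (φ : Cochain K R i) : ℕ :=
  sInf {k | ∃ φ' : Cochain K R i, φ - φ' ∈ coboundaries K R i ∧ (supp φ').card = k}

/-- `X` is exactly the support of a cocycle over `R` whose weight is `|X|`. -/
def SupportsCocycle {n : ℕ} {K : AbstractSimplicialComplex (Fin n)} {i : ℕ}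
    (X : Finset (Face K i)) (R : Type) [CommRing R] : Prop :=
  ∃ φ ∈ cocycles K R i, weight φ = X.card ∧ supp φ = X

/-- The property `z(X)`: the set `X` of `(d - 1)`-dimensional faces supports a cocycle of weight
`|X|` over `ℚ`, or over `ℤ/qℤ` for some prime `q ≤ √(d + 1) ^ |X|`. -/
def Z {n : ℕ} {K : AbstractSimplicialComplex (Fin n)} (d : ℕ)
    (X : Finset (Face K (d - 1))) : Prop :=
  SupportsCocycle X ℚ ∨
    ∃ q : ℕ, q.Prime ∧ (q : ℝ) ≤ Real.sqrt (d + 1) ^ X.card ∧ SupportsCocycle X (ZMod q)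

/-- A nonzero cocycle such that no nonzero cocycle over the same field is supported on a proper
subset of its support. -/
def IsInclusionMinimal {n : ℕ} {K : AbstractSimplicialComplex (Fin n)} {R : Type} [Field R] {i : ℕ}
    (φ : Cochain K R i) : Prop :=
  φ ∈ cocycles K R i ∧ φ ≠ 0 ∧ ∀ φ' ∈ cocycles K R i, φ' ≠ 0 → ¬ supp φ' ⊂ supp φ

/-- A facet, that is, a `(d - 1)`-dimensional face, that no `d`-dimensional face covers. -/
def IsIsolated {n : ℕ} {K : AbstractSimplicialComplex (Fin n)} (d : ℕ)
    (τ : Face K (d - 1)) : Prop :=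
  ∀ σ : Face K d, ¬ τ.1 ⊆ σ.1

/-- `K` has dimension at most `d` and every set of at most `d` vertices (the empty set aside) is a
face of `K`: the `(d - 1)`-skeleton is complete. -/
structure HasCompleteSkeleton {n : ℕ} (K : AbstractSimplicialComplex (Fin n)) (d : ℕ) : Prop where
  dim_le : ∀ s ∈ K.faces, s.card ≤ d + 1
  complete : ∀ s : Finset (Fin n), s.Nonempty → s.card ≤ d → s ∈ K.faces

/-- Large cocycle condition: `z(X)` fails whenever `|X| ≥ n / (3d)`. -/
def LargeCocycleCondition {n : ℕ} (K : AbstractSimplicialComplex (Fin n)) (d : ℕ) : Prop :=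
  ∀ X : Finset (Face K (d - 1)), (n : ℝ) / (3 * d) ≤ X.card → ¬ Z d X

/-- Small cocycle condition: over no field is there an inclusion-minimal `(d - 1)`-cocycle of
support size `k` with `2 ≤ k ≤ n / (3d)`. -/
def SmallCocycleCondition {n : ℕ} (K : AbstractSimplicialComplex (Fin n)) (d : ℕ) : Prop :=
  ∀ (R : Type) [Field R] (φ : Cochain K R (d - 1)), IsInclusionMinimal φ →
    ¬ (2 ≤ (supp φ).card ∧ ((supp φ).card : ℝ) ≤ (n : ℝ) / (3 * d))

/-- No two distinct isolated facets meet at a ridge, that is, in `d - 1` common vertices. -/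
def NoAdjacentIsolated {n : ℕ} (K : AbstractSimplicialComplex (Fin n)) (d : ℕ) : Prop :=
  ∀ τ τ' : Face K (d - 1), IsIsolated d τ → IsIsolated d τ' → τ ≠ τ' →
    (τ.1 ∩ τ'.1).card ≠ d - 1

/-- `L` arises from `K` by adding one new `d`-dimensional face. -/
def AddsFace {n : ℕ} (d : ℕ) (K L : AbstractSimplicialComplex (Fin n)) : Prop :=
  ∃ σ : Finset (Fin n), σ.card = d + 1 ∧ σ ∉ K.faces ∧ L.faces = insert σ K.faces

/-- `Y 0, …, Y N` is a realization of the process that starts at `K` and adds missing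
`d`-dimensional faces one at a time until no further one is missing. The realizations correspond to
the orderings of the missing `d`-dimensional faces. -/
structure IsRealization {n : ℕ} (d : ℕ) (K : AbstractSimplicialComplex (Fin n)) (N : ℕ)
    (Y : ℕ → AbstractSimplicialComplex (Fin n)) : Prop where
  start : Y 0 = K
  step : ∀ k < N, AddsFace d (Y k) (Y (k + 1))
  full : ∀ σ : Finset (Fin n), σ.card = d + 1 → σ ∈ (Y N).faces

end

end LinialMeshulam

open LinialMeshulam

/-! Call a `(d - 1)`-cocycle trivial if it is a coboundary plus a cochain supported on isolated
facets. The core is that all cocycles are trivial over every prime field (`cocycles_zmod_le`). A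
nontrivial cocycle of least support is inclusion-minimal and has weight equal to its support size.
The support has at least two facets, since a one-facet cocycle sits on an isolated facet; so
condition 2 makes it large, and condition 1 excludes it over `ℚ` and for small primes. If `p`
exceeds `√(d + 1) ^ |supp|`, the minors of the coboundary matrix on these columns are smaller than
`p` by Hadamard's inequality. The columns, dependent mod `p`, are then dependent over `ℤ`, and by
minimality the cocycle is a multiple of the reduction of an integral one. Integral cocycles are
trivial because rational ones are.

By duality, a cycle vanishing on the isolated facets is a boundary mod every `p`. Such cycles modulo
boundaries thus form a finitely generated group divisible by all primes, which is zero. Restriction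
to the isolated facets therefore embeds homology into the free group on them
(`nonempty_homology_equiv`). It is onto because isolated facets are few: each lies in a `(d +
1)`-set containing no other.

In the process, a `d`-face covering an original isolated facet contains no other one, by condition
3. Once all are covered, boundaries of such faces correct any cycle to one vanishing on the original
isolated facets, which already bounds in the starting complex. Conversely, an isolated facet always
carries homology. -/

namespace LinialMeshulam

/-! ### Cochain calculus, and coboundaries under a complete skeleton. -/

noncomputable section

variable {n : ℕ} {R : Type} [CommRing R]

/-- The sign `(-1) ^ k` of the vertex `v` in `s`, where `k` vertices of `s` precede `v`. -/
def vertexSign (s : Finset (Fin n)) (v : Fin n) : ℤ :=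
  (-1) ^ (s.filter (· < v)).card

theorem vertexSign_mul_self (s : Finset (Fin n)) (v : Fin n) :
    vertexSign s v * vertexSign s v = 1 := by
  rw [vertexSign, ← mul_pow]
  simp

theorem vertexSign_erase {s : Finset (Fin n)} {v : Fin n} (hv : v ∈ s) (w : Fin n) :
    vertexSign (s.erase v) w = if v < w then -vertexSign s w else vertexSign s w := by
  unfold vertexSign
  rw [Finset.filter_erase]
  split_ifs with h
  · have hm : v ∈ s.filter (· < w) := by simp [hv, h]
    rw [← Finset.card_erase_add_one hm, pow_succ]
    simp
  · rw [Finset.erase_eq_of_notMem (by simp [h])]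

/-- Deleting the smaller of the two vertices shifts the position of the larger one, and not
conversely, so exactly one sign flips. -/
theorem vertexSign_mul_vertexSign_erase {s : Finset (Fin n)} {v w : Fin n} (hv : v ∈ s)
    (hw : w ∈ s) (hvw : v ≠ w) :
    vertexSign s v * vertexSign (s.erase v) w = -(vertexSign s w * vertexSign (s.erase w) v) := by
  rw [vertexSign_erase hv, vertexSign_erase hw]
  rcases lt_or_gt_of_ne hvw with h | h
  · rw [if_pos h, if_neg h.asymm]
    ring
  · rw [if_neg h.asymm, if_pos h]
    ring

/-- The simplicial coboundary formula, for functions on all finite sets of vertices. -/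
def alternatingSum (f : Finset (Fin n) → R) (s : Finset (Fin n)) : R :=
  ∑ v ∈ s, (vertexSign s v : R) * f (s.erase v)

theorem alternatingSum_congr {f g : Finset (Fin n) → R} {s : Finset (Fin n)}
    (h : ∀ v ∈ s, f (s.erase v) = g (s.erase v)) : alternatingSum f s = alternatingSum g s :=
  Finset.sum_congr rfl fun v hv => by rw [h v hv]

/-- Exchanging the two deleted vertices is a sign-reversing involution without fixed points. -/
theorem alternatingSum_alternatingSum (f : Finset (Fin n) → R) (s : Finset (Fin n)) :
    alternatingSum (alternatingSum f) s = 0 := by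
  simp only [alternatingSum, Finset.mul_sum, Finset.sum_sigma']
  refine Finset.sum_involution (fun x _ => ⟨x.2, x.1⟩) ?_ ?_ ?_ ?_
  · rintro ⟨v, w⟩ h
    simp only [Finset.mem_sigma, Finset.mem_erase] at h
    have := congrArg (Int.cast : ℤ → R) (vertexSign_mul_vertexSign_erase h.1 h.2.2 (Ne.symm h.2.1))
    push_cast at this
    simp only [← mul_assoc, this, Finset.erase_right_comm (a := v) (b := w)]
    ring
  · rintro ⟨v, w⟩ h _ heq
    simp only [Finset.mem_sigma, Finset.mem_erase] at h
    simp only [Sigma.mk.injEq, heq_eq_eq] at heq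
    exact h.2.1 heq.1
  · rintro ⟨v, w⟩ h
    simp only [Finset.mem_sigma, Finset.mem_erase] at h ⊢
    exact ⟨h.2.2, Ne.symm h.2.1, h.1⟩
  · rintro ⟨v, w⟩ _
    rfl

/-- The cone operator with apex the least vertex. -/
def cone [NeZero n] (f : Finset (Fin n) → R) (s : Finset (Fin n)) : R :=
  if 0 ∈ s then 0 else f (insert 0 s)

theorem vertexSign_zero [NeZero n] (s : Finset (Fin n)) : vertexSign s 0 = 1 := by
  simp [vertexSign]

/-- The cone is a contracting homotopy of the full simplex. Its apex is the least vertex, hence has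
sign `+1` and shifts every other sign by one. -/
theorem alternatingSum_cone_add [NeZero n] (f : Finset (Fin n) → R) (s : Finset (Fin n)) :
    alternatingSum (cone f) s + cone (alternatingSum f) s = f s := by
  by_cases h : (0 : Fin n) ∈ s
  · rw [cone, if_pos h, add_zero, alternatingSum, Finset.sum_eq_single_of_mem 0 h]
    · simp [cone, vertexSign_zero, Finset.insert_erase h]
    · intro v hv hv0
      simp [cone, h, hv0.symm]
  · rw [cone, if_neg h, alternatingSum, alternatingSum, Finset.sum_insert h,
      Finset.erase_insert h, vertexSign_zero, Int.cast_one, one_mul, add_left_comm,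
      ← Finset.sum_add_distrib, Finset.sum_eq_zero, add_zero]
    intro v hv
    have hv0 : v ≠ 0 := fun h0 => h (h0 ▸ hv)
    have h1 := vertexSign_erase (Finset.mem_insert_self 0 s) v
    rw [Finset.erase_insert h, if_pos (Fin.pos_iff_ne_zero.2 hv0)] at h1
    rw [h1, cone, if_neg (by simp [h]), Finset.erase_insert_of_ne hv0.symm]
    push_cast
    ring

variable {K : AbstractSimplicialComplex (Fin n)} {i j : ℕ}

open Classical in
/-- The extension by zero of a cochain to all finite sets of vertices. -/
def extend (φ : Face K i → R) (s : Finset (Fin n)) : R :=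
  if h : s ∈ K.faces ∧ s.card = i + 1 then φ ⟨s, h⟩ else 0

@[simp]
theorem extend_coe (φ : Face K i → R) (τ : Face K i) : extend φ τ.1 = φ τ := by
  simp [extend, τ.2.1, τ.2.2]

/-- This bridges the matrix definitions and the formula on all finite sets; `s` need not be a face,
so coboundaries can be tested on missing simplices. -/
theorem sum_incidence_mul (s : Finset (Fin n)) (φ : Face K i → R) :
    ∑ τ : Face K i, (incidence s τ.1 : R) * φ τ = alternatingSum (extend φ) s := by
  simp only [incidence, alternatingSum, Int.cast_sum, Finset.sum_mul]
  rw [Finset.sum_comm]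
  refine Finset.sum_congr rfl fun v _ => ?_
  by_cases h : s.erase v ∈ K.faces ∧ (s.erase v).card = i + 1
  · rw [Finset.sum_eq_single_of_mem ⟨s.erase v, h⟩ (Finset.mem_univ _)]
    · simp [extend, h, vertexSign]
    · intro τ _ hτ
      rw [if_neg fun h' => hτ (Subtype.ext h'.symm)]
      simp
  · rw [extend, dif_neg h, mul_zero]
    refine Finset.sum_eq_zero fun τ _ => ?_
    rw [if_neg fun h' => h (by rw [h']; exact τ.2)]
    simp

theorem coboundary_apply (φ : Cochain K R j) (σ : Face K i) :
    coboundary K R j i φ σ = alternatingSum (extend φ) σ.1 :=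
  sum_incidence_mul σ.1 φ

theorem incidence_eq_alternatingSum (s t : Finset (Fin n)) :
    (incidence s t : R) = alternatingSum (fun u => if u = t then 1 else 0) s := by
  simp [incidence, alternatingSum, vertexSign]

theorem incidence_eq_zero {s t : Finset (Fin n)} (h : ¬ (t ⊆ s ∧ s.card = t.card + 1)) :
    incidence s t = 0 := by
  refine Finset.sum_eq_zero fun v hv => if_neg ?_
  rintro rfl
  exact h ⟨Finset.erase_subset _ _, (Finset.card_erase_add_one hv).symm⟩

theorem incidence_insert {t : Finset (Fin n)} {v : Fin n} (hv : v ∉ t) :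
    incidence (insert v t) t = vertexSign (insert v t) v := by
  rw [incidence, Finset.sum_eq_single_of_mem v (Finset.mem_insert_self v t)]
  · rw [if_pos (Finset.erase_insert hv), vertexSign]
  · intro w hw hwv
    rw [if_neg]
    intro h
    exact hv (h ▸ Finset.mem_erase.2 ⟨hwv.symm, Finset.mem_insert_self v t⟩)

/-- If `f` vanishes on all other facets of `insert v τ`, its coboundary there is `± f τ`. -/
theorem alternatingSum_extend_insert (f : Face K i → R) (τ : Face K i) {v : Fin n} (hv : v ∉ τ.1)
    (h : ∀ τ' : Face K i, τ'.1 ⊆ insert v τ.1 → f τ' ≠ 0 → τ' = τ) :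
    alternatingSum (extend f) (insert v τ.1) = (vertexSign (insert v τ.1) v : R) * f τ := by
  rw [← sum_incidence_mul, Finset.sum_eq_single_of_mem τ (Finset.mem_univ _),
    incidence_insert hv]
  intro τ' _ hne
  by_cases h0 : f τ' = 0
  · rw [h0, mul_zero]
  · rw [incidence_eq_zero fun hc => hne (h τ' hc.1 h0), Int.cast_zero, zero_mul]

theorem alternatingSum_extend_sub (f g : Face K i → R) (s : Finset (Fin n)) :
    alternatingSum (extend (f - g)) s
      = alternatingSum (extend f) s - alternatingSum (extend g) s := by
  simp [← sum_incidence_mul, mul_sub]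

theorem alternatingSum_extend_map {S : Type} [CommRing S] (g : R →+* S) (f : Face K i → R)
    (s : Finset (Fin n)) :
    alternatingSum (extend fun τ => g (f τ)) s = g (alternatingSum (extend f) s) := by
  simp [← sum_incidence_mul]

theorem mem_cocycles_iff {φ : Cochain K R i} :
    φ ∈ cocycles K R i ↔ ∀ σ : Face K (i + 1), alternatingSum (extend φ) σ.1 = 0 := by
  rw [cocycles, LinearMap.mem_ker, funext_iff]
  simp [coboundary_apply]

/-- With complete `(d - 1)`-skeleton, the `(d - 1)`-coboundaries are the cocycles of the full
simplex. -/
theorem mem_coboundaries_iff (hK : HasCompleteSkeleton K (j + 2)) {φ : Cochain K R (j + 1)} :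
    φ ∈ coboundaries K R (j + 1) ↔
      ∀ s : Finset (Fin n), s.card = j + 3 → alternatingSum (extend φ) s = 0 := by
  constructor
  · rintro ⟨ψ, rfl⟩ s hs
    rw [← alternatingSum_alternatingSum (extend ψ) s]
    refine alternatingSum_congr fun v hv => ?_
    have hc : (s.erase v).card = j + 1 + 1 := by
      rw [Finset.card_erase_of_mem hv, hs]
      rfl
    have hf : s.erase v ∈ K.faces :=
      hK.complete _ (Finset.card_pos.1 (by omega)) (by omega)
    rw [← coboundary_apply (i := j + 1) ψ ⟨s.erase v, hf, hc⟩]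
    exact extend_coe _ (⟨s.erase v, hf, hc⟩ : Face K (j + 1))
  · intro h
    -- The cone needs an apex; without vertices there are no facets.
    rcases Nat.eq_zero_or_pos n with rfl | hn
    · refine ⟨0, funext fun τ => ?_⟩
      have h1 := τ.2.2
      have h2 := τ.1.card_le_univ
      rw [Fintype.card_fin] at h2
      omega
    have : NeZero n := ⟨hn.ne'⟩
    refine ⟨fun τ => cone (extend φ) τ.1, funext fun τ => ?_⟩
    have key := alternatingSum_cone_add (extend φ) τ.1
    rw [extend_coe] at key
    refine (coboundary_apply (i := j + 1) (j := j) _ τ).trans (.trans ?_ key)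
    have h0 : cone (alternatingSum (extend φ)) τ.1 = 0 := by
      unfold cone
      split_ifs with h'
      · rfl
      · exact h _ (by rw [Finset.card_insert_of_notMem h', τ.2.2])
    rw [h0, add_zero]
    refine alternatingSum_congr fun v hv => ?_
    have hc : (τ.1.erase v).card = j + 1 := by
      rw [Finset.card_erase_of_mem hv, τ.2.2]
      rfl
    exact extend_coe _ (⟨τ.1.erase v, hK.complete _ (Finset.card_pos.1 (by omega)) (by omega),
      hc⟩ : Face K j)

theorem coboundaries_le_cocycles (hK : HasCompleteSkeleton K (j + 2)) :
    coboundaries K R (j + 1) ≤ cocycles K R (j + 1) := fun _ h =>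
  mem_cocycles_iff.2 fun σ => (mem_coboundaries_iff hK).1 h σ.1 σ.2.2

/-- A small set of facets has, through each of its members, a simplex with no second member. -/
theorem exists_vertex_forall_subset_insert (S : Finset (Face K i)) (hS : S.card + (i + 1) ≤ n)
    {τ : Face K i} (hτ : τ ∈ S) :
    ∃ v ∉ τ.1, ∀ τ' ∈ S, τ'.1 ⊆ insert v τ.1 → τ' = τ := by
  classical
  by_contra! hcon
  have h (v : Fin n) : ∃ τ', v ∉ τ.1 → τ' ∈ S ∧ τ'.1 ⊆ insert v τ.1 ∧ τ' ≠ τ := by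
    by_cases hv : v ∈ τ.1
    · exact ⟨τ, fun h => absurd hv h⟩
    · obtain ⟨τ', h⟩ := hcon v hv
      exact ⟨τ', fun _ => h⟩
  choose g hg using h
  -- Pigeonhole: there are more vertices `v` off `τ` than candidates `g v`, so two vertices `v ≠ w`
  -- share one `τ'`. It lies in both `insert v τ` and `insert w τ`, hence in `τ`.
  have hlt : (S.erase τ).card < (τ.1ᶜ).card := by
    have h1 := Finset.card_erase_add_one hτ
    have h2 := Finset.card_add_card_compl τ.1
    rw [τ.2.2, Fintype.card_fin] at h2
    omega
  obtain ⟨v, hv, w, hw, hvw, heq⟩ := Finset.exists_ne_map_eq_of_card_lt_of_maps_to hlt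
    (f := g) fun v hv => by
      obtain ⟨h1, -, h3⟩ := hg v (Finset.mem_compl.1 hv)
      exact Finset.mem_erase.2 ⟨h3, h1⟩
  obtain ⟨-, h2, h3⟩ := hg v (Finset.mem_compl.1 hv)
  obtain ⟨-, h4, -⟩ := hg w (Finset.mem_compl.1 hw)
  refine h3 (Subtype.ext (Finset.eq_of_subset_of_card_le (fun x hx => ?_) ?_))
  · have h5 := Finset.mem_insert.1 (h2 hx)
    have h6 := Finset.mem_insert.1 (h4 (heq ▸ hx))
    rcases h5 with rfl | h5
    · rcases h6 with rfl | h6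
      · exact absurd rfl hvw
      · exact h6
    · exact h5
  · rw [τ.2.2, (g v).2.2]

/-- A nonzero coboundary has at least `n - d + 1` facets in its support. -/
theorem eq_zero_of_mem_coboundaries (hK : HasCompleteSkeleton K (j + 2)) {φ : Cochain K R (j + 1)}
    (h : φ ∈ coboundaries K R (j + 1)) (S : Finset (Face K (j + 1)))
    (hS : S.card + (j + 2) ≤ n) (hφ : ∀ τ, φ τ ≠ 0 → τ ∈ S) : φ = 0 := by
  funext τ
  by_contra hτ
  obtain ⟨v, hv, hvS⟩ := exists_vertex_forall_subset_insert S hS (hφ τ hτ)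
  have h1 := alternatingSum_extend_insert φ τ hv fun τ' h1 h2 => hvS τ' (hφ τ' h2) h1
  rw [(mem_coboundaries_iff hK).1 h _ (by rw [Finset.card_insert_of_notMem hv, τ.2.2])] at h1
  have h2 := congrArg (Int.cast : ℤ → R) (vertexSign_mul_self (insert v τ.1) v)
  push_cast at h2
  apply hτ
  calc φ τ = (vertexSign (insert v τ.1) v : R) * (vertexSign (insert v τ.1) v * φ τ) := by
        rw [← mul_assoc, h2, one_mul]
    _ = 0 := by rw [← h1, mul_zero]

end

end LinialMeshulam

/-! ### Linear algebra: Hadamard's bound, integral kernel vectors, divisible groups. -/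

namespace LinialMeshulam

/-- A form of Hadamard's inequality: AM-GM for the eigenvalues of `A * Aᵀ`. -/
theorem det_sq_le_pow {ι : Type} [Fintype ι] [DecidableEq ι] (A : Matrix ι ι ℝ) (D : ℝ)
    (hD : ∀ r, ∑ c, A r c ^ 2 ≤ D) : A.det ^ 2 ≤ D ^ Fintype.card ι := by
  rcases isEmpty_or_nonempty ι with h | h
  · simp
  have hP : (A * A.conjTranspose).PosSemidef := Matrix.posSemidef_self_mul_conjTranspose A
  have hdet : A.det ^ 2 = ∏ i, hP.isHermitian.eigenvalues i := by
    have h1 := hP.isHermitian.det_eq_prod_eigenvalues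
    rw [Matrix.det_mul, Matrix.det_conjTranspose, star_trivial] at h1
    simpa [sq] using h1
  have htr : ∑ i, hP.isHermitian.eigenvalues i ≤ Fintype.card ι * D := by
    have h1 := hP.isHermitian.trace_eq_sum_eigenvalues
    simp only [RCLike.ofReal_real_eq_id, id_eq] at h1
    rw [← h1, Matrix.trace]
    refine (Finset.sum_le_sum (g := fun _ => D) fun r _ => ?_).trans (by simp)
    simpa [Matrix.mul_apply, ← sq] using hD r
  have hc : (0 : ℝ) < Fintype.card ι := by exact_mod_cast Fintype.card_pos
  have hnn : ∀ i ∈ Finset.univ, 0 ≤ hP.isHermitian.eigenvalues i :=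
    fun i _ => hP.eigenvalues_nonneg i
  have hamgm := Real.geom_mean_le_arith_mean Finset.univ (fun _ : ι => (1 : ℝ))
    hP.isHermitian.eigenvalues (fun _ _ => zero_le_one) (by simpa using hc) hnn
  simp only [Real.rpow_one, Finset.sum_const, Finset.card_univ, nsmul_eq_mul, mul_one,
    one_mul] at hamgm
  rw [hdet]
  have hp := Finset.prod_nonneg hnn
  calc ∏ i, hP.isHermitian.eigenvalues i
      = ((∏ i, hP.isHermitian.eigenvalues i) ^ ((Fintype.card ι : ℝ)⁻¹)) ^ Fintype.card ι := by
        rw [← Real.rpow_natCast, ← Real.rpow_mul hp, inv_mul_cancel₀ hc.ne', Real.rpow_one]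
    _ ≤ D ^ Fintype.card ι := by
        refine pow_le_pow_left₀ (Real.rpow_nonneg hp _) (hamgm.trans ?_) _
        rw [div_le_iff₀ hc, mul_comm]
        exact htr

/-- An integer matrix with independent columns has a nonzero minor of full size. -/
theorem exists_submatrix_det_ne_zero {m ι : Type} [Fintype m] [Fintype ι] [DecidableEq ι]
    (A : Matrix m ι ℤ) (hA : ∀ v : ι → ℤ, A.mulVec v = 0 → v = 0) :
    ∃ f : ι → m, (A.submatrix f id).det ≠ 0 := by
  -- Clearing denominators carries independence from `ℤ` to `ℚ`, where row rank equals column rank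
  -- and enough independent rows can be chosen.
  have hAQ : LinearMap.ker (A.map (Int.cast : ℤ → ℚ)).mulVecLin = ⊥ := by
    rw [LinearMap.ker_eq_bot']
    intro x hx
    obtain ⟨b, hb⟩ := IsLocalization.exist_integer_multiples_of_finite (nonZeroDivisors ℤ) x
    choose v hv using hb
    have hb0 : (b.1 : ℚ) ≠ 0 := by exact_mod_cast nonZeroDivisors.coe_ne_zero b
    have hv' (c : ι) : (v c : ℚ) = b.1 * x c := by
      simpa [Submonoid.smul_def] using hv c
    have h0 : v = 0 := hA v <| funext fun r => by
      have h1 := congrFun hx r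
      simp only [Matrix.mulVecLin_apply, Matrix.mulVec, dotProduct, Matrix.map_apply,
        Pi.zero_apply] at h1 ⊢
      have h2 : ((∑ c, A r c * v c : ℤ) : ℚ) = 0 := by
        push_cast
        simp only [hv', mul_left_comm _ (b.1 : ℚ), ← Finset.mul_sum, h1, mul_zero]
      exact_mod_cast h2
    funext c
    have h3 := hv' c
    simpa [h0, hb0] using h3
  have hrank : Module.finrank ℚ (Submodule.span ℚ (Set.range (A.map (Int.cast : ℤ → ℚ)).row))
      = Fintype.card ι := by
    rw [← Matrix.rank_eq_finrank_span_row]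
    have := LinearMap.finrank_range_add_finrank_ker (A.map (Int.cast : ℤ → ℚ)).mulVecLin
    rw [hAQ, finrank_bot, add_zero] at this
    simpa [Matrix.rank] using this
  obtain ⟨f, hf, -, hli⟩ := Submodule.exists_fun_fin_finrank_span_eq ℚ
    (Set.range (A.map (Int.cast : ℤ → ℚ)).row)
  choose g hg using hf
  let e : ι ≃ Fin (Module.finrank ℚ (Submodule.span ℚ
      (Set.range (A.map (Int.cast : ℤ → ℚ)).row))) :=
    Fintype.equivFinOfCardEq hrank.symm
  refine ⟨g ∘ e, fun h0 => ?_⟩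
  have hli' := hli.comp e e.injective
  have hM : (f ∘ e) = ((A.submatrix (g ∘ e) id).map (Int.cast : ℤ → ℚ)).row := by
    funext i c
    exact (congrFun (hg (e i)) c).symm
  rw [hM, Matrix.linearIndependent_rows_iff_isUnit, Matrix.isUnit_iff_isUnit_det] at hli'
  have h1 : ((A.submatrix (g ∘ e) id).map (Int.cast : ℤ → ℚ)).det = 0 := by
    have := (Int.castRingHom ℚ).map_det (A.submatrix (g ∘ e) id)
    rw [h0, map_zero] at this
    exact this.symm
  rw [h1] at hli'
  exact not_isUnit_zero hli'

/-- An integer matrix that is singular modulo a large prime has an integer kernel vector that does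
not vanish modulo this prime. -/
theorem exists_int_kernel_vector {m ι : Type} [Fintype m] [Fintype ι] (A : Matrix m ι ℤ) (D : ℕ)
    (hD : ∀ r, ∑ c, A r c ^ 2 ≤ D) (p : ℕ) [Fact p.Prime]
    (hp : Real.sqrt D ^ Fintype.card ι < p) (x : ι → ZMod p) (hx : x ≠ 0)
    (hAx : (A.map (Int.cast : ℤ → ZMod p)).mulVec x = 0) :
    ∃ v : ι → ℤ, A.mulVec v = 0 ∧ ∃ c, (v c : ZMod p) ≠ 0 := by
  classical
  -- Were the columns independent, some full minor would be nonzero, divisible by `p`, and yet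
  -- smaller than `p` in absolute value.
  by_cases hA : ∀ v : ι → ℤ, A.mulVec v = 0 → v = 0
  · exfalso
    obtain ⟨f, hf⟩ := exists_submatrix_det_ne_zero A hA
    have hmod : ((A.submatrix f id).det : ZMod p) = 0 := by
      by_contra hne
      have hne' : ((A.submatrix f id).map (Int.cast : ℤ → ZMod p)).det ≠ 0 := by
        have := (Int.castRingHom (ZMod p)).map_det (A.submatrix f id)
        intro h0
        exact hne (this.trans h0)
      refine hx (Matrix.eq_zero_of_mulVec_eq_zero hne' (funext fun i => ?_))
      exact congrFun hAx (f i)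
    rw [ZMod.intCast_zmod_eq_zero_iff_dvd] at hmod
    have hle : (p : ℤ) ≤ |(A.submatrix f id).det| :=
      Int.le_of_dvd (abs_pos.2 hf) ((dvd_abs _ _).2 hmod)
    have hdet := det_sq_le_pow ((A.submatrix f id).map (Int.cast : ℤ → ℝ)) D fun r => by
      have := hD (f r)
      simp only [Matrix.map_apply, Matrix.submatrix_apply, id]
      exact_mod_cast this
    have hcast : ((A.submatrix f id).map (Int.cast : ℤ → ℝ)).det
        = ((A.submatrix f id).det : ℝ) :=
      ((Int.castRingHom ℝ).map_det (A.submatrix f id)).symm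
    rw [hcast] at hdet
    have h1 : (p : ℝ) ≤ |((A.submatrix f id).det : ℝ)| := by exact_mod_cast hle
    have h2 : ((A.submatrix f id).det : ℝ) ^ 2 < (p : ℝ) ^ 2 := by
      refine hdet.trans_lt ?_
      have h3 : (D : ℝ) ^ Fintype.card ι = (Real.sqrt D ^ Fintype.card ι) ^ 2 := by
        rw [← pow_mul, mul_comm, pow_mul, Real.sq_sqrt (Nat.cast_nonneg D)]
      rw [h3]
      exact pow_lt_pow_left₀ hp (by positivity) two_ne_zero
    rw [← sq_abs] at h2
    exact absurd (lt_of_pow_lt_pow_left₀ 2 (by positivity) h2) (not_lt.2 h1)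
  · push Not at hA
    obtain ⟨w, hw, hw0⟩ := hA
    obtain ⟨c₀, hc₀⟩ := Function.ne_iff.1 hw0
    -- Dividing by the gcd of the entries leaves a kernel vector that `p` does not divide.
    obtain ⟨v, hv, hgcd⟩ := Finset.univ.extract_gcd w ⟨c₀, Finset.mem_univ _⟩
    have hg : Finset.univ.gcd w ≠ 0 := fun h =>
      hc₀ (Finset.gcd_eq_zero_iff.1 h c₀ (Finset.mem_univ _))
    refine ⟨v, ?_, ?_⟩
    · have hsm : w = Finset.univ.gcd w • v := funext fun c => hv c (Finset.mem_univ _)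
      rw [hsm, Matrix.mulVec_smul] at hw
      exact (smul_eq_zero.1 hw).resolve_left hg
    · by_contra! h
      have h1 : (p : ℤ) ∣ Finset.univ.gcd v :=
        Finset.dvd_gcd fun c _ => (ZMod.intCast_zmod_eq_zero_iff_dvd _ _).1 (h c)
      rw [hgcd] at h1
      have h2 := Int.le_of_dvd one_pos h1
      have h3 := (Fact.out : p.Prime).two_le
      omega

/-- A finitely generated abelian group that is divisible by all primes is trivial. -/
theorem subsingleton_of_forall_prime_smul {M : Type} [AddCommGroup M] [hM : Module ℤ M]
    [Module.Finite ℤ M] (h : ∀ p : ℕ, p.Prime → ∀ x : M, ∃ y : M, x = p • y) :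
    Subsingleton M := by
  obtain rfl : hM = AddCommGroup.toIntModule M := Subsingleton.elim _ _
  have hdiv (m : ℕ) : m ≠ 0 → ∀ x : M, ∃ y : M, x = m • y := by
    induction m using induction_on_primes with
    | zero => exact fun h => absurd rfl h
    | one => exact fun _ x => ⟨x, (one_nsmul x).symm⟩
    | prime_mul p a hp ih =>
      intro hm x
      obtain ⟨y, rfl⟩ := h p hp x
      obtain ⟨z, rfl⟩ := ih (right_ne_zero_of_mul hm) y
      exact ⟨z, (mul_nsmul' z p a).symm⟩
  -- Nakayama for `M = 2M`: some odd `r`, hence nonzero, annihilates `M`. Since `M` is also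
  -- divisible by `r`, it is zero.
  obtain ⟨r, hr, hrM⟩ := Submodule.exists_sub_one_mem_and_smul_eq_zero_of_fg_of_le_smul
    (Ideal.span {(2 : ℤ)}) (⊤ : Submodule ℤ M) Module.Finite.fg_top fun x _ => by
      obtain ⟨y, rfl⟩ := hdiv 2 two_ne_zero x
      rw [← Nat.cast_smul_eq_nsmul ℤ]
      exact Submodule.smul_mem_smul (Ideal.mem_span_singleton_self _) Submodule.mem_top
  have hr0 : r ≠ 0 := by
    rintro rfl
    rw [Ideal.mem_span_singleton] at hr
    omega
  have hzero (x : M) : x = 0 := by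
    obtain ⟨y, rfl⟩ := hdiv r.natAbs (Int.natAbs_ne_zero.2 hr0) x
    rw [← Nat.cast_smul_eq_nsmul ℤ]
    rcases Int.natAbs_eq r with h' | h'
    · rw [← h', hrM y Submodule.mem_top]
    · rw [← neg_eq_iff_eq_neg.2 h', neg_smul, hrM y Submodule.mem_top, neg_zero]
  exact ⟨fun x y => (hzero x).trans (hzero y).symm⟩

end LinialMeshulam

/-! ### Triviality of all cocycles over `ℚ`, `ℤ` and the prime fields. -/

namespace LinialMeshulam

noncomputable section

variable {n j : ℕ} {K : AbstractSimplicialComplex (Fin n)} {R : Type} [CommRing R]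

theorem vertexSign_mul_vertexSign_mul (s : Finset (Fin n)) (v : Fin n) (x : R) :
    (vertexSign s v : R) * (vertexSign s v * x) = x := by
  rw [← mul_assoc, ← Int.cast_mul, vertexSign_mul_self, Int.cast_one, one_mul]

theorem eq_zero_of_vertexSign_mul_eq_zero {s : Finset (Fin n)} {v : Fin n} {x : R}
    (h : (vertexSign s v : R) * x = 0) : x = 0 := by
  rw [← vertexSign_mul_vertexSign_mul s v x, h, mul_zero]

theorem mem_supp {i : ℕ} {φ : Cochain K R i} {τ : Face K i} : τ ∈ supp φ ↔ φ τ ≠ 0 := by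
  simp [supp]

/-- The cochains that vanish on all facets that are not isolated. -/
def isolatedCochains (K : AbstractSimplicialComplex (Fin n)) (R : Type) [CommRing R] (j : ℕ) :
    Submodule R (Cochain K R (j + 1)) where
  carrier := {φ | ∀ τ : Face K (j + 1), ¬ IsIsolated (j + 2) τ → φ τ = 0}
  add_mem' h h' τ hτ := by simp [h τ hτ, h' τ hτ]
  zero_mem' _ _ := rfl
  smul_mem' c φ h τ hτ := by simp [h τ hτ]

theorem isolatedCochains_le_cocycles : isolatedCochains K R j ≤ cocycles K R (j + 1) := by
  intro φ h
  refine mem_cocycles_iff.2 fun σ => ?_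
  rw [← sum_incidence_mul]
  refine Finset.sum_eq_zero fun τ _ => ?_
  by_cases hτ : IsIsolated (j + 2) τ
  · rw [incidence_eq_zero fun hc => hτ σ hc.1, Int.cast_zero, zero_mul]
  · rw [h τ hτ, mul_zero]

/-- The cocycles that come from isolated facets, up to coboundaries. -/
def trivialCocycles (K : AbstractSimplicialComplex (Fin n)) (R : Type) [CommRing R] (j : ℕ) :
    Submodule R (Cochain K R (j + 1)) :=
  isolatedCochains K R j ⊔ coboundaries K R (j + 1)

theorem mem_trivialCocycles {φ : Cochain K R (j + 1)} : φ ∈ trivialCocycles K R j ↔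
    ∃ a ∈ isolatedCochains K R j, ∃ b ∈ coboundaries K R (j + 1), a + b = φ :=
  Submodule.mem_sup

theorem weight_eq_card_supp {i : ℕ} {φ : Cochain K R i}
    (h : ∀ φ', φ - φ' ∈ coboundaries K R i → (supp φ).card ≤ (supp φ').card) :
    weight φ = (supp φ).card := by
  have h0 : (supp φ).card ∈
      {k | ∃ φ' : Cochain K R i, φ - φ' ∈ coboundaries K R i ∧ (supp φ').card = k} :=
    ⟨φ, by rw [sub_self]; exact zero_mem _, rfl⟩
  refine le_antisymm (Nat.sInf_le h0) (le_csInf ⟨_, h0⟩ ?_)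
  rintro k ⟨φ', h', rfl⟩
  exact h φ' h'

/-- There are few isolated facets: otherwise some of them would carry a heavy cocycle. -/
theorem card_isolated_add_le (hn : j + 3 ≤ n) (hK : HasCompleteSkeleton K (j + 2))
    (h₁ : LargeCocycleCondition K (j + 2)) (I : Finset (Face K (j + 1)))
    (hI : ∀ τ ∈ I, IsIsolated (j + 2) τ) : I.card + (j + 2) ≤ n := by
  classical
  by_contra! hlt
  set s := ⌈(n : ℝ) / (3 * ((j + 2 : ℕ) : ℝ))⌉₊ with hs
  have hpos : (0 : ℝ) < 3 * ((j + 2 : ℕ) : ℝ) := by positivity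
  have hs1 : 3 * (j + 2) * s < n + 3 * (j + 2) := by
    have h1 : (s : ℝ) < (n : ℝ) / (3 * ((j + 2 : ℕ) : ℝ)) + 1 :=
      Nat.ceil_lt_add_one (by positivity)
    rw [div_add_one hpos.ne', lt_div_iff₀ hpos, mul_comm] at h1
    exact_mod_cast h1
  -- A cochain lighter than `s` and one of support size `s` occupy together at most `2 * s - 1`
  -- facets. This bound keeps that number below the least support size of a nonzero coboundary. The
  -- case `s < 2` needs `n ≥ d + 1`.
  have hs2 : 2 * s + (j + 1) ≤ n := by
    rcases Nat.lt_or_ge s 2 with h | h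
    · omega
    · obtain ⟨t, ht⟩ : ∃ t, s = t + 2 := ⟨s - 2, by omega⟩
      rw [ht] at hs1 ⊢
      nlinarith
  have hs0 : 0 < s := Nat.ceil_pos.2 (div_pos (by exact_mod_cast (by omega : 0 < n)) hpos)
  obtain ⟨X, hXI, hXs⟩ := Finset.exists_subset_card_eq (show s ≤ I.card by omega)
  let φ : Cochain K ℚ (j + 1) := fun τ => if τ ∈ X then 1 else 0
  have hsupp : supp φ = X := by
    ext τ
    simp [mem_supp, φ]
  refine h₁ X (hXs ▸ Nat.le_ceil _) (Or.inl ⟨φ, isolatedCochains_le_cocycles ?_, ?_, hsupp⟩)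
  · intro τ hτ
    exact if_neg fun h => hτ (hI τ (hXI h))
  · rw [← hsupp]
    refine weight_eq_card_supp fun (φ' : Cochain K ℚ (j + 1)) h => ?_
    by_contra! hc
    have h0 : φ - φ' = 0 := by
      refine eq_zero_of_mem_coboundaries hK h (supp φ ∪ supp φ') ?_ fun τ hτ => ?_
      · have := Finset.card_union_le (supp φ) (supp φ')
        rw [hsupp, hXs] at this hc
        rw [hsupp]
        omega
      · simp only [Finset.mem_union, mem_supp]
        by_contra! h'
        exact hτ (by simp [h'.1, h'.2])
    rw [sub_eq_zero.1 h0] at hc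
    exact lt_irrefl _ hc

/-- A `d`-face over the only facet of the support would have coboundary value `± φ τ ≠ 0`. This
settles the support sizes that condition 2 leaves out. -/
theorem mem_isolatedCochains_of_card_supp_lt_two {φ : Cochain K R (j + 1)}
    (h : φ ∈ cocycles K R (j + 1)) (hφ : (supp φ).card < 2) : φ ∈ isolatedCochains K R j := by
  intro τ hτ
  by_contra h0
  obtain ⟨σ, hσ⟩ := not_forall_not.1 hτ
  obtain ⟨v, hv, hvσ⟩ := Finset.exists_eq_insert_iff.2
    ⟨hσ, by rw [τ.2.2, σ.2.2]⟩
  have h1 := alternatingSum_extend_insert φ τ hv fun τ' _ hτ' =>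
    Finset.card_le_one.1 (Nat.lt_succ_iff.1 hφ) τ' (mem_supp.2 hτ') τ (mem_supp.2 h0)
  rw [hvσ, mem_cocycles_iff.1 h σ] at h1
  exact h0 (eq_zero_of_vertexSign_mul_eq_zero h1.symm)

/-- The elimination step behind both uses of minimality: the multiple is chosen to cancel the value
at `τ`. -/
theorem supp_sub_smul_ssubset {F : Type} [Field F] {i : ℕ} {φ φ' : Cochain K F i}
    (hsub : supp φ' ⊆ supp φ) {τ : Face K i} (hτ : φ' τ ≠ 0) :
    supp (φ - (φ τ / φ' τ) • φ') ⊂ supp φ := by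
  refine Finset.ssubset_iff_subset_ne.2 ⟨fun τ' h => ?_, fun h => ?_⟩
  · rw [mem_supp] at h ⊢
    intro h0
    have h1 : φ' τ' = 0 := by
      by_contra hne
      exact mem_supp.1 (hsub (mem_supp.2 hne)) h0
    exact h (by simp [h0, h1])
  · have h1 := hsub (mem_supp.2 hτ)
    rw [← h, mem_supp] at h1
    exact h1 (by simp [hτ])

/-- A nontrivial cocycle of least support is inclusion-minimal, and it is heavy. -/
theorem exists_isInclusionMinimal {F : Type} [Field F]
    (hK : HasCompleteSkeleton K (j + 2)) (h₂ : SmallCocycleCondition K (j + 2))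
    (h : ¬ cocycles K F (j + 1) ≤ trivialCocycles K F j) :
    ∃ φ : Cochain K F (j + 1), IsInclusionMinimal φ ∧ φ ∉ trivialCocycles K F j ∧
      weight φ = (supp φ).card ∧ (n : ℝ) / (3 * ((j + 2 : ℕ) : ℝ)) ≤ (supp φ).card := by
  obtain ⟨φ₀, hφ₀, hφ₀'⟩ := Set.not_subset.1 h
  obtain ⟨φ, ⟨hφ, hφt⟩, hmin⟩ := (measure fun φ : Cochain K F (j + 1) => (supp φ).card).wf.has_min
    {φ | φ ∈ cocycles K F (j + 1) ∧ φ ∉ trivialCocycles K F j} ⟨φ₀, hφ₀, hφ₀'⟩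
  have hle (φ' : Cochain K F (j + 1)) (h1 : φ' ∈ cocycles K F (j + 1))
      (h2 : φ' ∉ trivialCocycles K F j) : (supp φ).card ≤ (supp φ').card :=
    not_lt.1 (hmin φ' ⟨h1, h2⟩)
  -- A cocycle `φ'` on a proper subset of the support is trivial by leastness, and so is `φ` minus
  -- the multiple of `φ'` cancelling one value. Then `φ` itself would be trivial.
  have hinc : IsInclusionMinimal φ := by
    refine ⟨hφ, fun h0 => hφt (h0 ▸ zero_mem _), fun φ' h1 h2 h3 => ?_⟩
    have ht : φ' ∈ trivialCocycles K F j := by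
      by_contra hc
      exact absurd (Finset.card_lt_card h3) (not_lt.2 (hle φ' h1 hc))
    obtain ⟨τ, hτ⟩ := Function.ne_iff.1 h2
    refine absurd (Finset.card_lt_card (supp_sub_smul_ssubset h3.subset hτ))
      (not_lt.2 (hle _ (sub_mem hφ (Submodule.smul_mem _ _ h1)) fun hc => hφt ?_))
    exact (Submodule.sub_mem_iff_left _ (Submodule.smul_mem _ _ ht)).1 hc
  refine ⟨φ, hinc, hφt, weight_eq_card_supp fun φ' h' => ?_, ?_⟩
  · by_cases hc : φ' ∈ trivialCocycles K F j
    · exact absurd ((Submodule.sub_mem_iff_left _ hc).1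
        ((le_sup_right : coboundaries K F (j + 1) ≤ trivialCocycles K F j) h')) hφt
    · exact hle φ' ((Submodule.sub_mem_iff_right _ hφ).1 (coboundaries_le_cocycles hK h')) hc
  · by_contra! hlt
    refine h₂ F φ hinc ⟨?_, hlt.le⟩
    by_contra! h2
    exact hφt ((le_sup_left : isolatedCochains K F j ≤ trivialCocycles K F j)
      (mem_isolatedCochains_of_card_supp_lt_two hφ h2))

theorem cocycles_rat_le (hK : HasCompleteSkeleton K (j + 2)) (h₁ : LargeCocycleCondition K (j + 2))
    (h₂ : SmallCocycleCondition K (j + 2)) :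
    cocycles K ℚ (j + 1) ≤ trivialCocycles K ℚ j := by
  by_contra h
  obtain ⟨φ, hφ, -, hw, hn⟩ := exists_isInclusionMinimal hK h₂ h
  exact h₁ (supp φ) hn (Or.inl ⟨φ, hφ.1, hw, rfl⟩)

/-- Write the cocycle over `ℚ` as isolated part `a` plus coboundary `b`. On a simplex whose only
isolated facet is `τ`, the coboundary of `b` vanishes, so `a τ` is up to sign a coboundary value of
the integral cochain `v`, hence an integer. The remainder is integral and a cocycle of the full
simplex, which makes it a coboundary over `ℤ`. -/
theorem cocycles_int_le (hK : HasCompleteSkeleton K (j + 2))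
    (hI : ∀ I : Finset (Face K (j + 1)), (∀ τ ∈ I, IsIsolated (j + 2) τ) → I.card + (j + 2) ≤ n)
    (hQ : cocycles K ℚ (j + 1) ≤ trivialCocycles K ℚ j) :
    cocycles K ℤ (j + 1) ≤ trivialCocycles K ℤ j := by
  classical
  intro v hv
  let vQ : Cochain K ℚ (j + 1) := fun τ => Int.castRingHom ℚ (v τ)
  have hvQ : vQ ∈ cocycles K ℚ (j + 1) := mem_cocycles_iff.2 fun σ => by
    rw [alternatingSum_extend_map, mem_cocycles_iff.1 hv σ, map_zero]
  obtain ⟨a, ha, b, hb, hab⟩ := mem_trivialCocycles.1 (hQ hvQ)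
  have hint (τ : Face K (j + 1)) : ∃ m : ℤ, Int.castRingHom ℚ m = a τ := by
    by_cases hτ : IsIsolated (j + 2) τ
    · let I : Finset (Face K (j + 1)) := Finset.univ.filter fun τ => IsIsolated (j + 2) τ
      have hI' : ∀ τ ∈ I, IsIsolated (j + 2) τ := fun τ h => (Finset.mem_filter.1 h).2
      obtain ⟨w, hw, hwI⟩ := exists_vertex_forall_subset_insert I (hI I hI') (τ := τ)
        (Finset.mem_filter.2 ⟨Finset.mem_univ _, hτ⟩)
      have h1 := alternatingSum_extend_insert a τ hw fun τ' h2 h3 =>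
        hwI τ' (Finset.mem_filter.2 ⟨Finset.mem_univ _, not_imp_comm.1 (ha τ') h3⟩) h2
      have h4 : alternatingSum (extend a) (insert w τ.1)
          = alternatingSum (extend vQ) (insert w τ.1) := by
        rw [← sub_eq_zero, ← alternatingSum_extend_sub, ← hab, sub_add_cancel_left]
        exact (mem_coboundaries_iff hK).1 (neg_mem hb) _
          (by rw [Finset.card_insert_of_notMem hw, τ.2.2])
      refine ⟨vertexSign (insert w τ.1) w * alternatingSum (extend v) (insert w τ.1), ?_⟩
      rw [map_mul, ← alternatingSum_extend_map]
      change ((vertexSign (insert w τ.1) w : ℤ) : ℚ) * alternatingSum (extend vQ) _ = _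
      rw [← h4, h1, vertexSign_mul_vertexSign_mul]
    · exact ⟨0, by rw [ha τ hτ, map_zero]⟩
  choose m hm using hint
  refine mem_trivialCocycles.2 ⟨m, fun τ hτ => ?_, v - m, ?_, by abel⟩
  · have h1 := hm τ
    rw [ha τ hτ] at h1
    simpa using h1
  · refine (mem_coboundaries_iff hK).2 fun s hs => ?_
    have h1 : (fun τ => Int.castRingHom ℚ ((v - m) τ)) = b := by
      rw [← sub_eq_iff_eq_add'.2 hab.symm]
      funext τ
      simp only [Pi.sub_apply, map_sub, hm, vQ]
    have h2 := (mem_coboundaries_iff hK).1 hb s hs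
    rw [← h1, alternatingSum_extend_map] at h2
    simpa using h2

theorem map_mem_trivialCocycles (hK : HasCompleteSkeleton K (j + 2)) {S : Type} [CommRing S]
    (g : R →+* S) {φ : Cochain K R (j + 1)} (h : φ ∈ trivialCocycles K R j) :
    (fun τ => g (φ τ)) ∈ trivialCocycles K S j := by
  obtain ⟨a, ha, b, hb, rfl⟩ := mem_trivialCocycles.1 h
  refine mem_trivialCocycles.2 ⟨fun τ => g (a τ), fun τ hτ => ?_, fun τ => g (b τ), ?_, ?_⟩
  · simp only [ha τ hτ, map_zero]
  · refine (mem_coboundaries_iff hK).2 fun s hs => ?_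
    rw [alternatingSum_extend_map, (mem_coboundaries_iff hK).1 hb s hs, map_zero]
  · funext τ
    simp

theorem incidence_sq_le (s t : Finset (Fin n)) :
    incidence s t ^ 2 ≤ if t ∈ s.image s.erase then 1 else 0 := by
  by_cases h : t ∈ s.image s.erase
  · obtain ⟨v, hv, rfl⟩ := Finset.mem_image.1 h
    rw [if_pos h]
    have h1 := incidence_insert (Finset.notMem_erase v s)
    rw [Finset.insert_erase hv] at h1
    rw [h1, sq, vertexSign_mul_self]
  · rw [if_neg h, incidence, Finset.sum_eq_zero, sq, zero_mul]
    exact fun v hv => if_neg fun h' => h (Finset.mem_image.2 ⟨v, hv, h'⟩)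

/-- A row of the coboundary matrix has at most one entry `±1` per deleted vertex; hence the base
`√(d + 1)` in the Hadamard bound. -/
theorem sum_incidence_sq_le {i : ℕ} (s : Finset (Fin n)) (X : Finset (Face K i)) :
    ∑ τ : X, incidence s τ.1.1 ^ 2 ≤ s.card := by
  rw [Finset.sum_coe_sort X fun τ => incidence s τ.1 ^ 2]
  refine (Finset.sum_le_sum fun τ _ => incidence_sq_le s τ.1).trans ?_
  rw [Finset.sum_boole, Nat.cast_le]
  refine (Finset.card_le_card_of_injOn (t := s.image s.erase) (fun τ => τ.1)
    (fun τ h => ?_) Subtype.val_injective.injOn).trans Finset.card_image_le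
  exact (Finset.mem_filter.1 h).2

/-- Over a large prime field an inclusion-minimal cocycle comes from an integral cocycle. -/
theorem mem_trivialCocycles_of_sqrt_pow_lt (hK : HasCompleteSkeleton K (j + 2))
    (hZ : cocycles K ℤ (j + 1) ≤ trivialCocycles K ℤ j) {p : ℕ} [Fact p.Prime]
    {φ : Cochain K (ZMod p) (j + 1)} (hφ : IsInclusionMinimal φ)
    (hp : Real.sqrt ((j + 3 : ℕ) : ℝ) ^ (supp φ).card < p) : φ ∈ trivialCocycles K (ZMod p) j := by
  classical
  obtain ⟨hc, h0, hmin⟩ := hφ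
  let A : Matrix (Face K (j + 2)) (supp φ) ℤ := Matrix.of fun σ τ => incidence σ.1 τ.1.1
  have hsum {S : Type} [CommRing S] (f : Cochain K S (j + 1)) (hf : ∀ τ, τ ∉ supp φ → f τ = 0)
      (σ : Face K (j + 2)) :
      ∑ τ : supp φ, (incidence σ.1 τ.1.1 : S) * f τ.1 = alternatingSum (extend f) σ.1 := by
    rw [← sum_incidence_mul, Finset.sum_coe_sort (supp φ) fun τ => (incidence σ.1 τ.1 : S) * f τ]
    exact Finset.sum_subset (Finset.subset_univ _) fun τ _ h => by rw [hf τ h, mul_zero]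
  obtain ⟨u, hu, c, huc⟩ := exists_int_kernel_vector A (j + 3)
    (fun σ => (sum_incidence_sq_le σ.1 (supp φ)).trans (by rw [σ.2.2])) p
    (by rwa [Fintype.card_coe]) (fun τ => φ τ.1)
    (fun hz => by
      obtain ⟨τ, hτ⟩ := Function.ne_iff.1 h0
      exact hτ (congrFun hz ⟨τ, mem_supp.2 hτ⟩))
    (funext fun σ => (hsum φ (fun τ h => not_not.1 (mt mem_supp.2 h)) σ).trans
      (mem_cocycles_iff.1 hc σ))
  let v : Cochain K ℤ (j + 1) := fun τ => if h : τ ∈ supp φ then u ⟨τ, h⟩ else 0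
  have hvu (τ : supp φ) : v τ.1 = u τ := dif_pos τ.2
  have hv0 (τ : Face K (j + 1)) (h : τ ∉ supp φ) : v τ = 0 := dif_neg h
  have hv : v ∈ cocycles K ℤ (j + 1) := mem_cocycles_iff.2 fun σ => by
    rw [← hsum v hv0 σ]
    simpa [hvu, A, Matrix.mulVec, dotProduct] using congrFun hu σ
  let w : Cochain K (ZMod p) (j + 1) := fun τ => Int.castRingHom (ZMod p) (v τ)
  have hw : w ∈ trivialCocycles K (ZMod p) j := map_mem_trivialCocycles hK _ (hZ hv)
  have hwc : w ∈ cocycles K (ZMod p) (j + 1) := mem_cocycles_iff.2 fun σ => by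
    rw [alternatingSum_extend_map, mem_cocycles_iff.1 hv σ, map_zero]
  have hwτ : w c.1 ≠ 0 := by
    simpa [w, hvu] using huc
  have hsub : supp w ⊆ supp φ := fun τ h => by
    by_contra h'
    exact mem_supp.1 h (by simp [w, hv0 τ h'])
  -- The difference is a cocycle on a proper subset of `supp φ`, so minimality makes it zero.
  have hz : φ - (φ c.1 / w c.1) • w = 0 := by
    by_contra hne
    exact hmin _ (sub_mem hc (Submodule.smul_mem _ _ hwc)) hne (supp_sub_smul_ssubset hsub hwτ)
  rw [sub_eq_zero.1 hz]
  exact Submodule.smul_mem _ _ hw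

/-- Condition 1 excludes a least nontrivial cocycle for primes up to its bound; beyond the bound,
lifting to `ℤ` does. -/
theorem cocycles_zmod_le (hn : j + 3 ≤ n) (hK : HasCompleteSkeleton K (j + 2))
    (h₁ : LargeCocycleCondition K (j + 2)) (h₂ : SmallCocycleCondition K (j + 2)) (p : ℕ)
    [Fact p.Prime] : cocycles K (ZMod p) (j + 1) ≤ trivialCocycles K (ZMod p) j := by
  by_contra h
  obtain ⟨φ, hφ, ht, hw, hcard⟩ := exists_isInclusionMinimal hK h₂ h
  by_cases hp : (p : ℝ) ≤ Real.sqrt ((j + 2 : ℕ) + 1) ^ (supp φ).card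
  · exact h₁ (supp φ) hcard (Or.inr ⟨p, Fact.out, hp, φ, hφ.1, hw, rfl⟩)
  · refine ht (mem_trivialCocycles_of_sqrt_pow_lt hK (cocycles_int_le hK
      (card_isolated_add_le hn hK h₁) (cocycles_rat_le hK h₁ h₂)) hφ ?_)
    have h3 : ((j + 3 : ℕ) : ℝ) = ((j + 2 : ℕ) : ℝ) + 1 := by push_cast; ring
    rw [h3]
    exact not_le.1 hp

end

end LinialMeshulam

/-! ### From cocycles over prime fields to integral homology. -/

namespace LinialMeshulam

noncomputable section

variable {n i j : ℕ} {K L : AbstractSimplicialComplex (Fin n)} {R : Type} [CommRing R]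

theorem boundary_apply (z : Chain K R i) (u : Face K j) :
    boundary K R i j z u = ∑ τ : Face K i, (incidence τ.1 u.1 : R) * z τ := rfl

/-- The boundary of the simplex with vertex set `s`, which need not be a face of `K`. -/
def simplexBoundary (K : AbstractSimplicialComplex (Fin n)) (i : ℕ) (s : Finset (Fin n)) :
    Chain K ℤ i := fun τ => incidence s τ.1

theorem boundary_eq_sum (y : Chain K ℤ i) :
    boundary K ℤ i j y = ∑ σ : Face K i, y σ • simplexBoundary K j σ.1 := by
  funext u
  rw [boundary_apply, Finset.sum_apply]
  exact Finset.sum_congr rfl fun σ _ => mul_comm _ _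

theorem simplexBoundary_mem_range (σ : Face K i) :
    simplexBoundary K j σ.1 ∈ LinearMap.range (boundary K ℤ i j) := by
  classical
  refine ⟨Pi.single σ 1, ?_⟩
  rw [boundary_eq_sum, Finset.sum_eq_single_of_mem σ (Finset.mem_univ _), Pi.single_eq_same,
    one_smul]
  intro σ' _ h
  rw [Pi.single_eq_of_ne h, zero_smul]

/-- The simplex may be missing from `K`: all its facets are present, so its boundary is still a
cycle. These cycles detect isolated facets. -/
theorem simplexBoundary_mem_ker (hK : HasCompleteSkeleton K (j + 2)) {s : Finset (Fin n)}
    (hs : s.card = j + 3) :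
    simplexBoundary K (j + 1) s ∈ LinearMap.ker (boundary K ℤ (j + 1) j) := by
  rw [LinearMap.mem_ker]
  funext u
  have h1 := sum_incidence_mul (R := ℤ) s fun τ : Face K (j + 1) => incidence τ.1 u.1
  have h2 := alternatingSum_alternatingSum (R := ℤ) (fun t => if t = u.1 then 1 else 0) s
  rw [boundary_apply, Pi.zero_apply, ← h2]
  refine Eq.trans ?_ (h1.trans (alternatingSum_congr fun v hv => ?_))
  · exact Finset.sum_congr rfl fun τ _ => mul_comm _ _
  · have hc : (s.erase v).card = j + 1 + 1 := by
      rw [Finset.card_erase_of_mem hv, hs]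
      rfl
    rw [← incidence_eq_alternatingSum]
    exact extend_coe (fun τ : Face K (j + 1) => incidence τ.1 u.1)
      ⟨s.erase v, hK.complete _ (Finset.card_pos.1 (by omega)) (by omega), hc⟩

theorem range_boundary_le_ker (hK : HasCompleteSkeleton K (j + 2)) :
    LinearMap.range (boundary K ℤ (j + 2) (j + 1)) ≤ LinearMap.ker (boundary K ℤ (j + 1) j) := by
  rintro _ ⟨y, rfl⟩
  rw [boundary_eq_sum]
  exact sum_mem fun σ _ => Submodule.smul_mem _ _ (simplexBoundary_mem_ker hK σ.2.2)

theorem apply_eq_zero_of_isIsolated {z : Chain K ℤ (j + 1)}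
    (hz : z ∈ LinearMap.range (boundary K ℤ (j + 2) (j + 1))) {τ : Face K (j + 1)}
    (hτ : IsIsolated (j + 2) τ) : z τ = 0 := by
  obtain ⟨y, rfl⟩ := hz
  rw [boundary_apply]
  exact Finset.sum_eq_zero fun σ _ => by
    rw [incidence_eq_zero fun hc => hτ σ hc.1, Int.cast_zero, zero_mul]

/-- Over a field a chain that is orthogonal to all cocycles is a boundary. -/
theorem mem_range_boundary_of_forall_cocycles {F : Type} [Field F] (z : Chain K F i)
    (h : ∀ φ ∈ cocycles K F i, ∑ τ, z τ * φ τ = 0) :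
    z ∈ LinearMap.range (boundary K F (i + 1) i) := by
  classical
  by_contra hz
  -- A functional killing all boundaries but not `z` is, through its values on single facets, a
  -- cocycle that pairs nontrivially with `z`.
  obtain ⟨f, hfz, hf⟩ := Submodule.exists_le_ker_of_notMem hz
  have hfx (x : Chain K F i) : f x = ∑ τ, x τ * f (Pi.single τ 1) := by
    rw [LinearMap.pi_apply_eq_sum_univ f x]
    refine Finset.sum_congr rfl fun τ _ => ?_
    rw [smul_eq_mul]
    congr 2
    funext τ'
    simp [Pi.single_apply, eq_comm]
  refine hfz ((hfx z).trans (h _ (mem_cocycles_iff.2 fun σ => ?_)))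
  rw [← sum_incidence_mul]
  have h1 := hf (LinearMap.mem_range_self (boundary K F (i + 1) i) (Pi.single σ 1))
  rw [LinearMap.mem_ker, hfx] at h1
  refine Eq.trans (Finset.sum_congr rfl fun τ _ => ?_) h1
  rw [boundary_apply, Finset.sum_eq_single_of_mem σ (Finset.mem_univ _), Pi.single_eq_same,
    mul_one]
  intro σ' _ hne
  rw [Pi.single_eq_of_ne hne, mul_zero]

theorem sum_mul_coboundary (z : Chain K R i) (ψ : Cochain K R j) :
    ∑ τ, z τ * coboundary K R j i ψ τ = ∑ u, boundary K R i j z u * ψ u := by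
  simp only [coboundary_apply, boundary_apply, ← sum_incidence_mul, Finset.mul_sum,
    Finset.sum_mul]
  rw [Finset.sum_comm]
  exact Finset.sum_congr rfl fun u _ => Finset.sum_congr rfl fun τ _ => by ring

theorem boundary_map (g : ℤ →+* R) (z : Chain K ℤ i) (u : Face K j) :
    boundary K R i j (fun τ => g (z τ)) u = g (boundary K ℤ i j z u) := by
  simp [boundary_apply]

/-- If all cocycles over all prime fields are trivial, the cycles that avoid the isolated facets
are boundaries. -/
theorem mem_range_boundary (hK : HasCompleteSkeleton K (j + 2))
    (hp : ∀ p : ℕ, [Fact p.Prime] → cocycles K (ZMod p) (j + 1) ≤ trivialCocycles K (ZMod p) j)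
    {z : Chain K ℤ (j + 1)} (hz : z ∈ LinearMap.ker (boundary K ℤ (j + 1) j))
    (hzI : ∀ τ : Face K (j + 1), IsIsolated (j + 2) τ → z τ = 0) :
    z ∈ LinearMap.range (boundary K ℤ (j + 2) (j + 1)) := by
  let N : Submodule ℤ (Chain K ℤ (j + 1)) :=
    { carrier := {z | z ∈ LinearMap.ker (boundary K ℤ (j + 1) j) ∧
        ∀ τ : Face K (j + 1), IsIsolated (j + 2) τ → z τ = 0}
      add_mem' := fun h h' => ⟨add_mem h.1 h'.1, fun τ hτ => by simp [h.2 τ hτ, h'.2 τ hτ]⟩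
      zero_mem' := ⟨zero_mem _, fun _ _ => rfl⟩
      smul_mem' := fun c _ h => ⟨Submodule.smul_mem _ c h.1, fun τ hτ => by simp [h.2 τ hτ]⟩ }
  let B := LinearMap.range (boundary K ℤ (j + 2) (j + 1))
  have hBN : B ≤ N := fun w hw =>
    ⟨range_boundary_le_ker hK hw, fun τ hτ => apply_eq_zero_of_isIsolated hw hτ⟩
  suffices hsub : Subsingleton (N ⧸ B.submoduleOf N) by
    rw [Submodule.Quotient.subsingleton_iff] at hsub
    have h1 : (⟨z, hz, hzI⟩ : N) ∈ B.submoduleOf N := hsub ▸ Submodule.mem_top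
    exact h1
  refine subsingleton_of_forall_prime_smul fun p hprime x => ?_
  obtain ⟨⟨w, hw, hwI⟩, rfl⟩ := Submodule.Quotient.mk_surjective _ x
  have : Fact p.Prime := ⟨hprime⟩
  let g := Int.castRingHom (ZMod p)
  -- Every cocycle is `a + δψ`. The part `a` lives where `w` vanishes, and pairing with `δψ` equals
  -- pairing `∂w = 0` with `ψ`.
  have hmod : (fun τ => g (w τ)) ∈ LinearMap.range (boundary K (ZMod p) (j + 2) (j + 1)) := by
    refine mem_range_boundary_of_forall_cocycles _ fun φ hφ => ?_
    obtain ⟨a, ha, b, ⟨ψ, rfl⟩, rfl⟩ := mem_trivialCocycles.1 (hp p hφ)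
    simp only [Pi.add_apply, mul_add, Finset.sum_add_distrib]
    rw [Finset.sum_eq_zero, zero_add]
    · refine (sum_mul_coboundary (fun τ => g (w τ)) ψ).trans (Finset.sum_eq_zero fun u _ => ?_)
      have h1 : boundary K ℤ (j + 1) j w = 0 := hw
      have h2 := boundary_map (j := j) g w u
      rw [h1, Pi.zero_apply, map_zero] at h2
      exact mul_eq_zero_of_left h2 _
    · intro τ _
      by_cases hτ : IsIsolated (j + 2) τ
      · rw [hwI τ hτ, map_zero, zero_mul]
      · rw [ha τ hτ, mul_zero]
  obtain ⟨y, hy⟩ := hmod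
  obtain ⟨y', rfl⟩ : ∃ y' : Chain K ℤ (j + 2), y = fun σ => g (y' σ) := by
    choose y' hy' using fun σ => ZMod.intCast_surjective (y σ)
    exact ⟨y', funext fun σ => (hy' σ).symm⟩
  have hdvd (τ : Face K (j + 1)) :
      ∃ t : ℤ, w τ - boundary K ℤ (j + 2) (j + 1) y' τ = p * t := by
    have h1 := congrFun hy τ
    rw [boundary_map] at h1
    refine (ZMod.intCast_zmod_eq_zero_iff_dvd _ p).1 ?_
    rw [Int.cast_sub, sub_eq_zero]
    exact h1.symm
  choose t ht using hdvd
  have hwt : w - boundary K ℤ (j + 2) (j + 1) y' = (p : ℤ) • t := funext ht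
  have hp0 : (p : ℤ) ≠ 0 := by exact_mod_cast hprime.ne_zero
  have hN : (p : ℤ) • t ∈ N :=
    hwt ▸ sub_mem (show w ∈ N from ⟨hw, hwI⟩) (hBN (LinearMap.mem_range_self _ _))
  -- `N` is cut out by equations over the torsion-free `ℤ`, so the factor `p` cancels. The class of
  -- `w` is then `p` times that of `t`.
  have htN : t ∈ N := by
    refine ⟨?_, fun τ hτ => ?_⟩
    · have h1 := hN.1
      rw [LinearMap.mem_ker, map_smul] at h1
      exact (smul_eq_zero.1 h1).resolve_left hp0
    · exact (mul_eq_zero.1 (hN.2 τ hτ)).resolve_left hp0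
  refine ⟨Submodule.Quotient.mk ⟨t, htN⟩, ?_⟩
  rw [← Nat.cast_smul_eq_nsmul ℤ, ← Submodule.Quotient.mk_smul, Submodule.Quotient.eq]
  change w - (p : ℤ) • t ∈ B
  rw [← hwt, sub_sub_cancel]
  exact LinearMap.mem_range_self _ _

theorem incidence_mul_self {t s : Finset (Fin n)} (h : t ⊆ s) (hc : s.card = t.card + 1) :
    incidence s t * incidence s t = 1 := by
  obtain ⟨v, hv, rfl⟩ := Finset.exists_eq_insert_iff.2 ⟨h, hc.symm⟩
  rw [incidence_insert hv, vertexSign_mul_self]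

/-- Simplices that contain one facet of `I` each give chains with prescribed values on `I`. -/
theorem exists_mem_forall_apply_eq (M : Submodule ℤ (Chain K ℤ i)) (I : Finset (Face K i))
    (h : ∀ τ ∈ I, ∃ s, simplexBoundary K i s ∈ M ∧ τ.1 ⊆ s ∧ s.card = i + 2 ∧
      ∀ τ' ∈ I, τ'.1 ⊆ s → τ' = τ) (c : Face K i → ℤ) :
    ∃ z ∈ M, ∀ τ ∈ I, z τ = c τ := by
  have h' (τ : Face K i) : ∃ s, τ ∈ I → simplexBoundary K i s ∈ M ∧ τ.1 ⊆ s ∧ s.card = i + 2 ∧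
      ∀ τ' ∈ I, τ'.1 ⊆ s → τ' = τ := by
    by_cases hτ : τ ∈ I
    · obtain ⟨s, hs⟩ := h τ hτ
      exact ⟨s, fun _ => hs⟩
    · exact ⟨∅, fun h => absurd h hτ⟩
  choose s hs using h'
  -- The chosen simplex boundaries form a diagonal matrix on `I` with entries `±1`; the factor
  -- `incidence (s τ) τ` cancels the sign.
  refine ⟨∑ τ ∈ I, (c τ * incidence (s τ) τ.1) • simplexBoundary K i (s τ),
    sum_mem fun τ hτ => Submodule.smul_mem _ _ (hs τ hτ).1, fun τ hτ => ?_⟩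
  rw [Finset.sum_apply, Finset.sum_eq_single_of_mem τ hτ]
  · rw [Pi.smul_apply, smul_eq_mul, simplexBoundary, mul_assoc,
      incidence_mul_self (hs τ hτ).2.1 (by rw [(hs τ hτ).2.2.1, τ.2.2]), mul_one]
  · intro τ' hτ' hne
    have h0 : incidence (s τ') τ.1 = 0 :=
      incidence_eq_zero fun hc => hne ((hs τ' hτ').2.2.2 τ hτ hc.1).symm
    rw [Pi.smul_apply, simplexBoundary, h0, smul_zero]

/-- The values on the isolated facets identify the homology group. -/
theorem nonempty_homology_equiv (hK : HasCompleteSkeleton K (j + 2))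
    (hI : ∀ I : Finset (Face K (j + 1)), (∀ τ ∈ I, IsIsolated (j + 2) τ) → I.card + (j + 2) ≤ n)
    (hp : ∀ p : ℕ, [Fact p.Prime] → cocycles K (ZMod p) (j + 1) ≤ trivialCocycles K (ZMod p) j) :
    Nonempty (Homology K (j + 1) ≃ₗ[ℤ] ({τ : Face K (j + 1) // IsIsolated (j + 2) τ} → ℤ)) := by
  classical
  let res : LinearMap.ker (boundary K ℤ (j + 1) j) →ₗ[ℤ]
      ({τ : Face K (j + 1) // IsIsolated (j + 2) τ} → ℤ) :=
    (LinearMap.funLeft ℤ ℤ Subtype.val).comp (Submodule.subtype _)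
  have hsurj : Function.Surjective res := by
    intro c
    let I : Finset (Face K (j + 1)) := Finset.univ.filter fun τ => IsIsolated (j + 2) τ
    have hI' : ∀ τ ∈ I, IsIsolated (j + 2) τ := fun τ h => (Finset.mem_filter.1 h).2
    obtain ⟨z, hz, hzc⟩ := exists_mem_forall_apply_eq (LinearMap.ker (boundary K ℤ (j + 1) j)) I
      (fun τ hτ => by
        obtain ⟨v, hv, h⟩ := exists_vertex_forall_subset_insert I (hI I hI') hτ
        have hc : (insert v τ.1).card = j + 3 := by
          rw [Finset.card_insert_of_notMem hv, τ.2.2]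
        exact ⟨insert v τ.1, simplexBoundary_mem_ker hK hc, Finset.subset_insert _ _, hc, h⟩)
      fun τ => if h : IsIsolated (j + 2) τ then c ⟨τ, h⟩ else 0
    refine ⟨⟨z, hz⟩, funext fun τ => ?_⟩
    refine (hzc τ.1 (Finset.mem_filter.2 ⟨Finset.mem_univ _, τ.2⟩)).trans ?_
    exact dif_pos τ.2
  have hker : (LinearMap.range (boundary K ℤ (j + 2) (j + 1))).submoduleOf
      (LinearMap.ker (boundary K ℤ (j + 1) j)) = LinearMap.ker res := by
    ext z
    rw [LinearMap.mem_ker]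
    constructor
    · exact fun h => funext fun τ => apply_eq_zero_of_isIsolated h τ.2
    · exact fun h => mem_range_boundary hK hp z.2 fun τ hτ => congrFun h ⟨τ, hτ⟩
  exact ⟨(Submodule.quotEquivOfEq _ _ hker).trans (res.quotKerEquivOfSurjective hsurj)⟩

theorem subsingleton_homology_iff : Subsingleton (Homology K (j + 1)) ↔
    ∀ z ∈ LinearMap.ker (boundary K ℤ (j + 1) j),
      z ∈ LinearMap.range (boundary K ℤ (j + 2) (j + 1)) := by
  rw [Submodule.Quotient.subsingleton_iff, Submodule.eq_top_iff']
  exact ⟨fun h z hz => h ⟨z, hz⟩, fun h z => h z.1 z.2⟩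

theorem exists_notMem_of_card_lt {s : Finset (Fin n)} (h : s.card < n) : ∃ v, v ∉ s := by
  by_contra! hs
  have := Finset.card_le_card (Finset.subset_iff.2 fun v (_ : v ∈ Finset.univ) => hs v)
  rw [Finset.card_univ, Fintype.card_fin] at this
  omega

/-- Some simplex through an isolated facet has as boundary a cycle with value `±1` there, while
every boundary of `d`-chains vanishes there. -/
theorem not_isIsolated_of_subsingleton_homology (hn : j + 3 ≤ n)
    (hK : HasCompleteSkeleton K (j + 2)) (h : Subsingleton (Homology K (j + 1)))
    (τ : Face K (j + 1)) : ¬ IsIsolated (j + 2) τ := by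
  intro hτ
  have hc := τ.2.2
  obtain ⟨v, hv⟩ := exists_notMem_of_card_lt (s := τ.1) (by omega)
  have hcard : (insert v τ.1).card = j + 3 := by rw [Finset.card_insert_of_notMem hv, hc]
  have h0 := apply_eq_zero_of_isIsolated
    (subsingleton_homology_iff.1 h _ (simplexBoundary_mem_ker hK hcard)) hτ
  have h1 := incidence_mul_self (Finset.subset_insert v τ.1) (by rw [hcard, hc])
  rw [simplexBoundary] at h0
  rw [h0, mul_zero] at h1
  exact zero_ne_one h1

/-- Once the isolated facets of `K` are covered in a larger complex, its homology vanishes. -/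
theorem subsingleton_homology_of_forall_not_isIsolated (hK : HasCompleteSkeleton K (j + 2))
    (hL : HasCompleteSkeleton L (j + 2)) (hKL : K.faces ⊆ L.faces)
    (hp : ∀ p : ℕ, [Fact p.Prime] → cocycles K (ZMod p) (j + 1) ≤ trivialCocycles K (ZMod p) j)
    (h₃ : NoAdjacentIsolated K (j + 2))
    (hiso : ∀ τ : Face L (j + 1), ¬ IsIsolated (j + 2) τ) :
    Subsingleton (Homology L (j + 1)) := by
  classical
  rw [subsingleton_homology_iff]
  intro z hz
  let e (τ : Face K (j + 1)) : Face L (j + 1) := ⟨τ.1, hKL τ.2.1, τ.2.2⟩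
  let e' (τ : Face L (j + 1)) : Face K (j + 1) :=
    ⟨τ.1, hK.complete _ (Finset.card_pos.1 (by rw [τ.2.2]; omega)) (by rw [τ.2.2]), τ.2.2⟩
  let eq : Face K (j + 1) ≃ Face L (j + 1) := ⟨e, e', fun _ => rfl, fun _ => rfl⟩
  let I : Finset (Face L (j + 1)) := Finset.univ.filter fun τ => IsIsolated (j + 2) (e' τ)
  -- Each facet isolated in `K` lies in a `d`-face `σ` of `L`. Two distinct facets in `σ` share `d -
  -- 1` vertices, so condition 3 leaves only one isolated facet of `K` in `σ`, and boundaries can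
  -- match `z` on all of them.
  obtain ⟨w, hw, hwI⟩ := exists_mem_forall_apply_eq
    (LinearMap.range (boundary L ℤ (j + 2) (j + 1))) I (fun τ hτ => by
      obtain ⟨σ, hσ⟩ := not_forall_not.1 (hiso τ)
      refine ⟨σ.1, simplexBoundary_mem_range (i := j + 2) σ, hσ, σ.2.2, fun τ' hτ' hs => ?_⟩
      by_contra hne
      refine h₃ (e' τ) (e' τ') (Finset.mem_filter.1 hτ).2 (Finset.mem_filter.1 hτ').2
        (fun h => hne (Subtype.ext (congrArg Subtype.val h).symm)) ?_
      change (τ.1 ∩ τ'.1).card = j + 1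
      have h1 := Finset.card_union_add_card_inter τ.1 τ'.1
      have h2 := Finset.card_le_card (Finset.union_subset hσ hs)
      have h3 : (τ.1 ∩ τ'.1).card < τ.1.card := by
        refine Finset.card_lt_card (Finset.ssubset_iff_subset_ne.2
          ⟨Finset.inter_subset_left, fun h => hne (Subtype.ext ?_)⟩)
        exact (Finset.eq_of_subset_of_card_le (Finset.inter_eq_left.1 h)
          (by rw [τ.2.2, τ'.2.2])).symm
      have h4 := τ.2.2
      have h5 := τ'.2.2
      have h6 := σ.2.2
      omega) z
  have hzw : z - w ∈ LinearMap.ker (boundary L ℤ (j + 1) j) :=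
    sub_mem hz (range_boundary_le_ker hL hw)
  -- `K` and `L` have the same facets, so the corrected cycle can be read in `K`, where it vanishes
  -- on the isolated facets and bounds.
  have hK' : (fun τ => (z - w) (e τ)) ∈ LinearMap.ker (boundary K ℤ (j + 1) j) := by
    rw [LinearMap.mem_ker] at hzw ⊢
    funext u
    refine Eq.trans ?_ (congrFun hzw ⟨u.1, hKL u.2.1, u.2.2⟩)
    exact eq.sum_comp fun τ : Face L (j + 1) => ((incidence τ.1 u.1 : ℤ) : ℤ) * (z - w) τ
  obtain ⟨y, hy⟩ := mem_range_boundary hK hp hK' fun τ hτ => by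
    rw [Pi.sub_apply, hwI (e τ) (Finset.mem_filter.2 ⟨Finset.mem_univ _, hτ⟩), sub_self]
  have hsum : z - w = ∑ σ : Face K (j + 2), y σ • simplexBoundary L (j + 1) σ.1 := by
    funext τ
    refine (congrFun hy (e' τ)).symm.trans ?_
    rw [boundary_eq_sum, Finset.sum_apply, Finset.sum_apply]
    rfl
  rw [← sub_add_cancel z w]
  refine add_mem (hsum ▸ sum_mem fun σ _ => Submodule.smul_mem _ _ ?_) hw
  exact simplexBoundary_mem_range (K := L) (i := j + 2) ⟨σ.1, hKL σ.2.1, σ.2.2⟩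

theorem forall_not_isIsolated_mono (hK : HasCompleteSkeleton K (j + 2))
    (hKL : K.faces ⊆ L.faces) (h : ∀ τ : Face K (j + 1), ¬ IsIsolated (j + 2) τ)
    (τ : Face L (j + 1)) : ¬ IsIsolated (j + 2) τ := by
  intro hτ
  refine h ⟨τ.1, hK.complete _ (Finset.card_pos.1 (by rw [τ.2.2]; omega)) (by rw [τ.2.2]), τ.2.2⟩
    fun σ hσ => ?_
  exact hτ ⟨σ.1, hKL σ.2.1, σ.2.2⟩ hσ

/-! ### Monotonicity along the process, and the main theorem. -/

section Realization

variable {d N : ℕ} {Y : ℕ → AbstractSimplicialComplex (Fin n)}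

theorem IsRealization.faces_subset (h : IsRealization d K N Y) {k l : ℕ} (hkl : k ≤ l)
    (hl : l ≤ N) : (Y k).faces ⊆ (Y l).faces := by
  induction l, hkl using Nat.le_induction with
  | base => exact subset_rfl
  | succ l _ ih =>
    obtain ⟨σ, -, -, hσ⟩ := h.step l (by omega)
    rw [hσ]
    exact (ih (by omega)).trans (Set.subset_insert _ _)

theorem IsRealization.hasCompleteSkeleton (h : IsRealization d K N Y)
    (hK : HasCompleteSkeleton K d) {k : ℕ} (hk : k ≤ N) : HasCompleteSkeleton (Y k) d := by
  induction k with
  | zero => rwa [h.start]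
  | succ k ih =>
    have ih := ih (by omega)
    obtain ⟨σ, hσc, -, hσ⟩ := h.step k (by omega)
    refine ⟨fun s hs => ?_, fun s hs hc => ?_⟩
    · rw [hσ] at hs
      rcases hs with rfl | hs
      · exact hσc.le
      · exact ih.dim_le s hs
    · rw [hσ]
      exact Set.mem_insert_of_mem _ (ih.complete s hs hc)

theorem IsRealization.not_isIsolated_last (hn : j + 3 ≤ n) (h : IsRealization (j + 2) K N Y)
    (τ : Face (Y N) (j + 1)) : ¬ IsIsolated (j + 2) τ := by
  intro hτ
  have hc := τ.2.2
  obtain ⟨v, hv⟩ := exists_notMem_of_card_lt (s := τ.1) (by omega)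
  have hcard : (insert v τ.1).card = j + 2 + 1 := by rw [Finset.card_insert_of_notMem hv, hc]
  exact hτ ⟨insert v τ.1, h.full _ hcard, hcard⟩ (Finset.subset_insert _ _)

end Realization

end

end LinialMeshulam

theorem mainTheorem4 (d n : ℕ) (hd : 2 ≤ d) (hn : d + 1 ≤ n)
    (K : AbstractSimplicialComplex (Fin n)) (hK : HasCompleteSkeleton K d)
    (h₁ : LargeCocycleCondition K d) (h₂ : SmallCocycleCondition K d) :
    (Module.Free ℤ (Homology K (d - 1)) ∧
      Module.rank ℤ (Homology K (d - 1)) =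
        (Nat.card {τ : Face K (d - 1) // IsIsolated d τ} : Cardinal)) ∧
    (NoAdjacentIsolated K d →
      ∀ (N : ℕ) (Y : ℕ → AbstractSimplicialComplex (Fin n)), IsRealization d K N Y →
        ∃ T ≤ N, ∀ k ≤ N,
          ((∀ τ : Face (Y k) (d - 1), ¬ IsIsolated d τ) ↔ T ≤ k) ∧
          (Subsingleton (Homology (Y k) (d - 1)) ↔ T ≤ k)) := by
  classical
  -- Writing `d = j + 2` turns the truncated `d - 1` and `d - 1 - 1` into `j + 1` and `j`.
  obtain ⟨j, rfl⟩ : ∃ j, d = j + 2 := ⟨d - 2, by omega⟩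
  have hp (p : ℕ) [Fact p.Prime] : cocycles K (ZMod p) (j + 1) ≤ trivialCocycles K (ZMod p) j :=
    cocycles_zmod_le hn hK h₁ h₂ p
  refine ⟨?_, fun h₃ N Y hY => ?_⟩
  · obtain ⟨e⟩ := nonempty_homology_equiv hK (card_isolated_add_le hn hK h₁) hp
    refine ⟨Module.Free.of_equiv e.symm, e.rank_eq.trans ?_⟩
    rw [rank_fun', Nat.card_eq_fintype_card]
    rfl
  -- `T` is the first time without isolated facets. `Y` is arbitrary beyond `N`, but the last
  -- complex already qualifies, so `T ≤ N`.
  · have hex : ∃ k, ∀ τ : Face (Y k) (j + 1), ¬ IsIsolated (j + 2) τ :=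
      ⟨N, hY.not_isIsolated_last hn⟩
    have hle : Nat.find hex ≤ N := Nat.find_min' hex (hY.not_isIsolated_last hn)
    refine ⟨Nat.find hex, hle, fun k hk => ?_⟩
    have hiff : (∀ τ : Face (Y k) (j + 1), ¬ IsIsolated (j + 2) τ) ↔ Nat.find hex ≤ k :=
      ⟨fun h => Nat.find_min' hex h, fun h => forall_not_isIsolated_mono
        (hY.hasCompleteSkeleton hK hle) (hY.faces_subset h hk) (Nat.find_spec hex)⟩
    refine ⟨hiff, Iff.trans ⟨fun h => ?_, fun h => ?_⟩ hiff⟩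
    · exact not_isIsolated_of_subsingleton_homology hn (hY.hasCompleteSkeleton hK hk) h
    · have hKY : K.faces ⊆ (Y k).faces := by
        have := hY.faces_subset (Nat.zero_le k) hk
        rwa [hY.start] at this
      exact subsingleton_homology_of_forall_not_isIsolated hK (hY.hasCompleteSkeleton hK hk) hKY
        hp h₃ h
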